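/- Let $\mathbf S^1=\mathbb R/\mathbb Z$, let $g_1,\dots,g_k$ be orientation preserving homeomorphisms of $\mathbf S^1$, let $\Gamma=\{g_1,\dots,g_k\}$, and let $p=(p_1,\dots,p_k)$ be a probability vector with all $p_i>0$. For a finite Borel measure $\mu$ on $\mathbf S^1$ put $P\mu=\sum_{i=1}^k p_i\,\mu\circ g_i^{-1}$, and for a continuous $f:\mathbf S^1\to\mathbb R$ put $P^*f(x)=\sum_{i=1}^k p_i f(g_i(x))$. For $\alpha\in\mathbb R$ let $T_\alpha(x)=x+\alpha \pmod 1$ denote the rotation by $\alpha$. Assume that $\Gamma$ contains two rotations $T_\alpha$ and $T_\beta$ with $\alpha,\beta\in\mathbb R$ and $\alpha-\beta$ irrational. Then: (1) for every continuous $f:\mathbf S^1\to\mathbb R$ with $f\ge 0$ and $f\not\equiv 0$ there exists an integer $r\ge 1$ such that $P^{*r}f(x)>0$ for all $x\in\mathbf S^1$; (2) the iterated function system $(\Gamma,p)$ is asymptotically stable: there is a Borel probability measure $\mu_*$ on $\mathbf S^1$ with $P\mu_*=\mu_*$, it is the only invariant Borel probability measure, and for every Borel probability measure $\nu$ and every continuous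 $f:\mathbf S^1\to\mathbb R$, $$\lim_{n\to\infty}\int_{\mathbf S^1} f\,d(P^n\nu)=\int_{\mathbf S^1} f\,d\mu_*.$$ -/

import Mathlib

open MeasureTheory Filter Topology
open scoped NNReal

noncomputable section

/-- A homeomorphism of the circle `ℝ / ℤ` (of length `1`) preserves orientation if it has a
continuous strictly increasing lift `F : ℝ → ℝ` with `F (x + 1) = F x + 1`. -/
def IsOrientationPreserving (g : UnitAddCircle ≃ₜ UnitAddCircle) : Prop :=
  ∃ F : ℝ → ℝ, Continuous F ∧ StrictMono F ∧ (∀ x, F (x + 1) = F x + 1) ∧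
    ∀ x : ℝ, g (x : UnitAddCircle) = (F x : UnitAddCircle)

/-- The rotation `T_α : x ↦ x + α` of the circle `ℝ / ℤ`. -/
def circleRotation (α : ℝ) : UnitAddCircle ≃ₜ UnitAddCircle :=
  Homeomorph.addRight (α : UnitAddCircle)

/-- The Markov operator `P μ = ∑ i, p i • (μ ∘ g i ⁻¹)` on finite Borel measures. -/
def markovOperator {k : ℕ} (g : Fin k → (UnitAddCircle ≃ₜ UnitAddCircle)) (p : Fin k → ℝ≥0)
    (μ : FiniteMeasure UnitAddCircle) : FiniteMeasure UnitAddCircle :=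
  ∑ i, p i • μ.map (g i)

/-- The dual operator `P* f (x) = ∑ i, p i * f (g i x)` on continuous functions. -/
def dualOperator {k : ℕ} (g : Fin k → (UnitAddCircle ≃ₜ UnitAddCircle)) (p : Fin k → ℝ≥0)
    (f : C(UnitAddCircle, ℝ)) : C(UnitAddCircle, ℝ) where
  toFun x := ∑ i, (p i : ℝ) * f (g i x)
  continuous_toFun := by fun_prop

/-- An operator `P` on finite Borel measures on the circle is asymptotically stable if it has a
unique invariant probability measure `μs` and, for every probability measure `ν`, the iterates
`P^n ν` converge to `μs` when integrated against continuous functions. -/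
def IsAsymptoticallyStable
    (P : FiniteMeasure UnitAddCircle → FiniteMeasure UnitAddCircle) : Prop :=
  ∃ μs : ProbabilityMeasure UnitAddCircle,
    P μs.toFiniteMeasure = μs.toFiniteMeasure ∧
    (∀ ν : ProbabilityMeasure UnitAddCircle,
      P ν.toFiniteMeasure = ν.toFiniteMeasure → ν = μs) ∧
    ∀ (f : C(UnitAddCircle, ℝ)) (ν : ProbabilityMeasure UnitAddCircle),
      Tendsto (fun n : ℕ => ∫ x, f x ∂(P^[n] ν.toFiniteMeasure : Measure UnitAddCircle)) atTop
        (𝓝 (∫ x, f x ∂(μs : Measure UnitAddCircle)))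

end

section MarkovOperators

variable {k : ℕ} (g : Fin k → (UnitAddCircle ≃ₜ UnitAddCircle)) (p : Fin k → ℝ≥0)

lemma dualOperator_apply (f : C(UnitAddCircle, ℝ)) (x : UnitAddCircle) :
    dualOperator g p f x = ∑ i, (p i : ℝ) * f (g i x) := rfl

lemma coe_markovOperator (μ : FiniteMeasure UnitAddCircle) :
    (markovOperator g p μ : Measure UnitAddCircle) =
      ∑ i, p i • (μ : Measure UnitAddCircle).map (g i) := by
  simp [markovOperator]

lemma integrable_continuousMap (f : C(UnitAddCircle, ℝ)) (μ : Measure UnitAddCircle)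
    [IsFiniteMeasure μ] : Integrable f μ :=
  f.continuous.integrable_of_hasCompactSupport (HasCompactSupport.of_compactSpace f)

lemma integral_markovOperator (μ : FiniteMeasure UnitAddCircle) (f : C(UnitAddCircle, ℝ)) :
    ∫ x, f x ∂(markovOperator g p μ : Measure UnitAddCircle) =
      ∫ x, dualOperator g p f x ∂(μ : Measure UnitAddCircle) := by
  have hint (i : Fin k) : Integrable (fun x => f (g i x)) (μ : Measure UnitAddCircle) :=
    integrable_continuousMap (f.comp (g i : C(UnitAddCircle, UnitAddCircle))) _
  rw [coe_markovOperator, integral_finsetSum_measure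
    (fun i _ => (integrable_continuousMap f _).smul_measure_nnreal)]
  simp only [dualOperator_apply]
  rw [integral_finsetSum _ (fun i _ => (hint i).const_mul _)]
  refine Finset.sum_congr rfl fun i _ => ?_
  rw [integral_smul_nnreal_measure, integral_const_mul,
    (g i).isClosedEmbedding.measurableEmbedding.integral_map]
  rfl

lemma integral_markovOperator_iterate (n : ℕ) (μ : FiniteMeasure UnitAddCircle)
    (f : C(UnitAddCircle, ℝ)) :
    ∫ x, f x ∂((markovOperator g p)^[n] μ : Measure UnitAddCircle) =
      ∫ x, (dualOperator g p)^[n] f x ∂(μ : Measure UnitAddCircle) := by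
  induction n generalizing μ with
  | zero => rfl
  | succ n ih =>
    rw [Function.iterate_succ_apply, ih, integral_markovOperator, Function.iterate_succ_apply']

lemma finiteMeasure_ext_of_integral_continuousMap {μ ν : FiniteMeasure UnitAddCircle}
    (h : ∀ f : C(UnitAddCircle, ℝ), ∫ x, f x ∂(μ : Measure UnitAddCircle) =
      ∫ x, f x ∂(ν : Measure UnitAddCircle)) : μ = ν := by
  apply FiniteMeasure.toMeasure_injective
  exact ext_of_forall_integral_eq_of_IsFiniteMeasure fun f => h f.toContinuousMap

variable {p}

lemma dualOperator_const (hp : ∑ i, p i = 1) (c : ℝ) :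
    dualOperator g p (ContinuousMap.const _ c) = ContinuousMap.const _ c := by
  ext x
  have : ∑ i, (p i : ℝ) = 1 := by exact_mod_cast hp
  simp [dualOperator_apply, ← Finset.sum_mul, this]

lemma dualOperator_sub (f h : C(UnitAddCircle, ℝ)) :
    dualOperator g p (f - h) = dualOperator g p f - dualOperator g p h := by
  ext x
  simp [dualOperator_apply, mul_sub]

lemma dualOperator_iterate_const (hp : ∑ i, p i = 1) (c : ℝ) (n : ℕ) :
    (dualOperator g p)^[n] (ContinuousMap.const _ c) = ContinuousMap.const _ c :=
  Function.iterate_fixed (dualOperator_const g hp c) n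

lemma dualOperator_iterate_sub (f h : C(UnitAddCircle, ℝ)) (n : ℕ) :
    (dualOperator g p)^[n] (f - h) = (dualOperator g p)^[n] f - (dualOperator g p)^[n] h := by
  induction n with
  | zero => rfl
  | succ n ih => simp only [Function.iterate_succ_apply', ih, dualOperator_sub]

lemma dualOperator_le_of_forall_le (hp : ∑ i, p i = 1) {f : C(UnitAddCircle, ℝ)} {c : ℝ}
    (h : ∀ x, f x ≤ c) (x : UnitAddCircle) : dualOperator g p f x ≤ c := by
  have hp' : ∑ i, (p i : ℝ) = 1 := by exact_mod_cast hp
  rw [dualOperator_apply]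
  calc ∑ i, (p i : ℝ) * f (g i x) ≤ ∑ i, (p i : ℝ) * c :=
        Finset.sum_le_sum fun i _ => mul_le_mul_of_nonneg_left (h _) (p i).2
    _ = c := by rw [← Finset.sum_mul, hp', one_mul]

lemma abs_dualOperator_le (hp : ∑ i, p i = 1) {f : C(UnitAddCircle, ℝ)} {c : ℝ}
    (h : ∀ x, |f x| ≤ c) (x : UnitAddCircle) : |dualOperator g p f x| ≤ c := by
  have hp' : ∑ i, (p i : ℝ) = 1 := by exact_mod_cast hp
  rw [dualOperator_apply]
  calc |∑ i, (p i : ℝ) * f (g i x)| ≤ ∑ i, |(p i : ℝ) * f (g i x)| := Finset.abs_sum_le_sum_abs _ _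
    _ ≤ ∑ i, (p i : ℝ) * c := Finset.sum_le_sum fun i _ => by
        rw [abs_mul, abs_of_nonneg (NNReal.coe_nonneg (p i))]
        exact mul_le_mul_of_nonneg_left (h _) (p i).2
    _ = c := by rw [← Finset.sum_mul, hp', one_mul]

lemma norm_dualOperator_le (hp : ∑ i, p i = 1) (f : C(UnitAddCircle, ℝ)) :
    ‖dualOperator g p f‖ ≤ ‖f‖ :=
  (ContinuousMap.norm_le _ (norm_nonneg _)).2 (abs_dualOperator_le g hp f.norm_coe_le_norm)

lemma norm_dualOperator_iterate_le (hp : ∑ i, p i = 1) (f : C(UnitAddCircle, ℝ)) (n : ℕ) :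
    ‖(dualOperator g p)^[n] f‖ ≤ ‖f‖ := by
  induction n with
  | zero => rfl
  | succ n ih =>
    rw [Function.iterate_succ_apply']
    exact (norm_dualOperator_le g hp _).trans ih

lemma continuous_dualOperator (hp : ∑ i, p i = 1) : Continuous (dualOperator g p) := by
  refine LipschitzWith.continuous (K := 1) (LipschitzWith.of_dist_le_mul fun f h => ?_)
  rw [dist_eq_norm, dist_eq_norm, ← dualOperator_sub, NNReal.coe_one, one_mul]
  exact norm_dualOperator_le g hp _

lemma dualOperator_nonneg {f : C(UnitAddCircle, ℝ)} (h : ∀ x, 0 ≤ f x) (x : UnitAddCircle) :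
    0 ≤ dualOperator g p f x := by
  rw [dualOperator_apply]
  exact Finset.sum_nonneg fun i _ => mul_nonneg (p i).2 (h _)

lemma dualOperator_iterate_nonneg {f : C(UnitAddCircle, ℝ)} (h : ∀ x, 0 ≤ f x) (n : ℕ)
    (x : UnitAddCircle) : 0 ≤ (dualOperator g p)^[n] f x := by
  induction n generalizing x with
  | zero => exact h x
  | succ n ih =>
    rw [Function.iterate_succ_apply']
    exact dualOperator_nonneg g ih x

lemma dualOperator_pos {f : C(UnitAddCircle, ℝ)} (hpos : ∀ i, 0 < p i) (h : ∀ x, 0 ≤ f x)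
    {x : UnitAddCircle} (i : Fin k) (hi : 0 < f (g i x)) : 0 < dualOperator g p f x := by
  rw [dualOperator_apply]
  exact Finset.sum_pos' (fun j _ => mul_nonneg (p j).2 (h _))
    ⟨i, Finset.mem_univ i, mul_pos (NNReal.coe_pos.2 (hpos i)) hi⟩

/-- A composition of `n` rotations, `m` of which are `T_α` and the others `T_β`, contributes a
positive term to the `n`-th iterate of the dual operator. -/
lemma dualOperator_iterate_pos_of_rotations {α β : ℝ} (hα : ∃ i, g i = circleRotation α)
    (hβ : ∃ j, g j = circleRotation β) (hpos : ∀ i, 0 < p i) {f : C(UnitAddCircle, ℝ)}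
    (h : ∀ x, 0 ≤ f x) (n m : ℕ) (x : UnitAddCircle)
    (hx : 0 < f (x + (m • (α : UnitAddCircle) + n • (β : UnitAddCircle)))) :
    0 < (dualOperator g p)^[m + n] f x := by
  obtain ⟨i, hi⟩ := hα
  obtain ⟨j, hj⟩ := hβ
  induction m generalizing x with
  | zero =>
    induction n generalizing x with
    | zero => simpa using hx
    | succ n ih =>
      rw [← add_assoc, Function.iterate_succ_apply']
      refine dualOperator_pos g hpos (dualOperator_iterate_nonneg g h _) j (ih _ ?_)
      rw [hj]
      convert hx using 2
      simp only [circleRotation, Homeomorph.coe_addRight, succ_nsmul]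
      abel
  | succ m ih =>
    rw [add_right_comm, Function.iterate_succ_apply']
    refine dualOperator_pos g hpos (dualOperator_iterate_nonneg g h _) i (ih _ ?_)
    rw [hi]
    convert hx using 2
    simp only [circleRotation, Homeomorph.coe_addRight, succ_nsmul]
    abel

lemma denseRange_nsmul_coe_of_irrational {γ : ℝ} (hγ : Irrational γ) :
    DenseRange fun n : ℕ => n • (γ : UnitAddCircle) := by
  have h : DenseRange fun n : ℤ => n • (γ : UnitAddCircle) :=
    AddCircle.denseRange_zsmul_coe_iff.2 (by simpa using hγ)
  intro x
  exact ((mapClusterPt_atTop_nsmul_tfae x (γ : UnitAddCircle)).out 2 3).2 (h x)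

/-- Two rotations whose angles differ by an irrational number make the iterates of the dual
operator positivity improving. -/
theorem exists_dualOperator_iterate_pos {α β : ℝ} (hαβ : Irrational (α - β))
    (hα : ∃ i, g i = circleRotation α) (hβ : ∃ j, g j = circleRotation β)
    (hpos : ∀ i, 0 < p i) {f : C(UnitAddCircle, ℝ)} (h : ∀ x, 0 ≤ f x) (hne : ∃ x, f x ≠ 0) :
    ∃ r : ℕ, 1 ≤ r ∧ ∀ x, 0 < (dualOperator g p)^[r] f x := by
  obtain ⟨x₀, hx₀⟩ := hne
  have hU : IsOpen {y | 0 < f y} := isOpen_lt continuous_const f.continuous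
  let V (n : ℕ) : Set UnitAddCircle :=
    (fun y => y + n • ((α - β : ℝ) : UnitAddCircle)) ⁻¹' {y | 0 < f y}
  have hV (n : ℕ) : IsOpen (V n) := hU.preimage (continuous_add_const _)
  obtain ⟨t, ht⟩ := isCompact_univ.elim_finite_subcover V hV fun y _ => by
    obtain ⟨n, hn⟩ := (denseRange_nsmul_coe_of_irrational hαβ).exists_mem_open
      (hU.preimage (continuous_const_add y)) ⟨-y + x₀, by simpa using (h x₀).lt_of_ne' hx₀⟩
    exact Set.mem_iUnion.2 ⟨n, hn⟩
  refine ⟨t.sup id + 1, Nat.le_add_left _ _, fun x => ?_⟩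
  obtain ⟨m, hmt, hm⟩ : ∃ m ∈ t, x + (t.sup id + 1) • (β : UnitAddCircle) ∈ V m := by
    simpa using ht (Set.mem_univ (x + (t.sup id + 1) • (β : UnitAddCircle)))
  have hle : m ≤ t.sup id + 1 := (Finset.le_sup (f := id) hmt).trans (Nat.le_succ _)
  obtain ⟨n, hn⟩ := Nat.exists_eq_add_of_le hle
  rw [hn] at hm ⊢
  refine dualOperator_iterate_pos_of_rotations g hα hβ hpos h n m x ?_
  convert (show 0 < f _ from hm) using 2
  rw [AddCircle.coe_sub, nsmul_sub, add_nsmul]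
  abel_nf

/-- Krylov–Bogoliubov: there is an invariant probability measure. -/
theorem exists_markovOperator_invariant (hp : ∑ i, p i = 1) :
    ∃ μ : ProbabilityMeasure UnitAddCircle,
      markovOperator g p μ.toFiniteMeasure = μ.toFiniteMeasure := by
  let ν : FiniteMeasure UnitAddCircle := ⟨Measure.dirac 0, inferInstance⟩
  let A (n : ℕ) : FiniteMeasure UnitAddCircle :=
    ((n : ℝ≥0) + 1)⁻¹ • ∑ j ∈ Finset.range (n + 1), (markovOperator g p)^[j] ν
  have hA (n : ℕ) (f : C(UnitAddCircle, ℝ)) : ∫ x, f x ∂(A n : Measure UnitAddCircle) =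
      ((n : ℝ) + 1)⁻¹ * ∑ j ∈ Finset.range (n + 1), (dualOperator g p)^[j] f 0 := by
    simp only [A, FiniteMeasure.toMeasure_smul, FiniteMeasure.toMeasure_sum]
    rw [integral_smul_nnreal_measure,
      integral_finsetSum_measure fun i _ => integrable_continuousMap f _]
    simp_rw [integral_markovOperator_iterate]
    simp [ν, NNReal.smul_def]
  have hprob (n : ℕ) : IsProbabilityMeasure (A n : Measure UnitAddCircle) := by
    have h1 := hA n (ContinuousMap.const _ 1)
    simp only [dualOperator_iterate_const g hp] at h1
    have h2 : ((n : ℝ) + 1)⁻¹ * (n + 1) = 1 := inv_mul_cancel₀ (by positivity)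
    refine ⟨?_⟩
    rw [← ENNReal.toReal_eq_one_iff]
    simpa [h2, Measure.real] using h1
  let B (n : ℕ) : ProbabilityMeasure UnitAddCircle := ⟨A n, hprob n⟩
  let F : Ultrafilter (ProbabilityMeasure UnitAddCircle) := (Filter.hyperfilter ℕ).map B
  have hF : Tendsto B (Filter.hyperfilter ℕ) (𝓝 F.lim) := F.le_nhds_lim
  rw [ProbabilityMeasure.tendsto_iff_forall_integral_tendsto] at hF
  have hlim (f : C(UnitAddCircle, ℝ)) : Tendsto (fun n => ∫ x, f x ∂(A n : Measure UnitAddCircle))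
      (Filter.hyperfilter ℕ) (𝓝 (∫ x, f x ∂(F.lim : Measure UnitAddCircle))) :=
    hF (BoundedContinuousFunction.mkOfCompact f)
  refine ⟨F.lim, finiteMeasure_ext_of_integral_continuousMap fun f => ?_⟩
  rw [integral_markovOperator]
  have hdiff (n : ℕ) : ∫ x, dualOperator g p f x ∂(A n : Measure UnitAddCircle) -
      ∫ x, f x ∂(A n : Measure UnitAddCircle) =
      ((n : ℝ) + 1)⁻¹ * ((dualOperator g p)^[n + 1] f 0 - f 0) := by
    rw [hA, hA, ← mul_sub, ← Finset.sum_sub_distrib]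
    simp only [← Function.iterate_succ_apply]
    rw [Finset.sum_range_sub (fun j => (dualOperator g p)^[j] f 0)]
    rfl
  have hzero : Tendsto (fun n : ℕ => ((n : ℝ) + 1)⁻¹ * ((dualOperator g p)^[n + 1] f 0 - f 0))
      atTop (𝓝 0) := by
    refine squeeze_zero_norm (a := fun n : ℕ => 1 / ((n : ℝ) + 1) * (‖f‖ + ‖f‖)) (fun n => ?_) ?_
    · rw [norm_mul, one_div, norm_inv, Real.norm_of_nonneg (by positivity : (0 : ℝ) ≤ n + 1)]
      gcongr
      exact (norm_sub_le _ _).trans (add_le_add ((ContinuousMap.norm_coe_le_norm _ _).trans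
        (norm_dualOperator_iterate_le g hp f _)) (f.norm_coe_le_norm _))
    · simpa using tendsto_one_div_add_atTop_nhds_zero_nat.mul_const (‖f‖ + ‖f‖)
  have hzero' := hzero.mono_left (Nat.hyperfilter_le_atTop)
  simp only [← hdiff] at hzero'
  exact sub_eq_zero.1 (tendsto_nhds_unique ((hlim _).sub (hlim f)) hzero')

end MarkovOperators

section BackwardInvariantMeasure

variable {k : ℕ} {g : Fin k → (UnitAddCircle ≃ₜ UnitAddCircle)} {p : Fin k → ℝ≥0}

lemma circleRotation_symm (α : ℝ) : (circleRotation α).symm = circleRotation (-α) := by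
  ext x
  rw [Homeomorph.symm_apply_eq]
  simp [circleRotation]

lemma measure_eq_sum_of_symm_invariant {m : ProbabilityMeasure UnitAddCircle}
    (hm : markovOperator (fun i => (g i).symm) p m.toFiniteMeasure = m.toFiniteMeasure)
    (s : Set UnitAddCircle) :
    (m : Measure UnitAddCircle).real s =
      ∑ i, (p i : ℝ) * (m : Measure UnitAddCircle).real (g i '' s) := by
  have h : (m : Measure UnitAddCircle) =
      ∑ i, p i • (m : Measure UnitAddCircle).map (g i).symm := by
    conv_lhs => rw [← ProbabilityMeasure.toMeasure_comp_toFiniteMeasure_eq_toMeasure, ← hm]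
    rw [coe_markovOperator]
    rfl
  have hs : (m : Measure UnitAddCircle) s =
      ∑ i, (p i : ENNReal) * (m : Measure UnitAddCircle) (g i '' s) := by
    conv_lhs => rw [h]
    rw [Measure.coe_finsetSum, Finset.sum_apply]
    refine Finset.sum_congr rfl fun i _ => ?_
    rw [Measure.smul_apply, (g i).symm.isClosedEmbedding.measurableEmbedding.map_apply,
      (g i).image_eq_preimage_symm]
    rfl
  rw [Measure.real, hs, ENNReal.toReal_sum fun i _ => by finiteness]
  simp [Measure.real]

/-- An invariant measure of the inverse system has full support. -/
lemma isOpenPosMeasure_of_symm_invariant {α β : ℝ} (hαβ : Irrational (α - β))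
    (hα : ∃ i, g i = circleRotation α) (hβ : ∃ j, g j = circleRotation β)
    (hpos : ∀ i, 0 < p i) {m : ProbabilityMeasure UnitAddCircle}
    (hm : markovOperator (fun i => (g i).symm) p m.toFiniteMeasure = m.toFiniteMeasure) :
    (m : Measure UnitAddCircle).IsOpenPosMeasure := by
  refine ⟨fun U hU ⟨x₀, hx₀⟩ hzero => ?_⟩
  have hαβ' : Irrational (-α - -β) := by
    rw [← neg_sub']
    exact hαβ.neg
  obtain ⟨f, hf0, hf1, hf⟩ := exists_continuous_zero_one_of_isClosed hU.isClosed_compl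
    (isClosed_singleton (x := x₀)) (by simpa using hx₀)
  obtain ⟨r, -, hr⟩ := exists_dualOperator_iterate_pos (fun i => (g i).symm) hαβ'
    (hα.imp fun i hi => by rw [hi, circleRotation_symm])
    (hβ.imp fun i hi => by rw [hi, circleRotation_symm]) hpos (f := f) (fun x => (hf x).1)
    ⟨x₀, by simp [hf1 (Set.mem_singleton x₀)]⟩
  have hint : ∫ x, (dualOperator (fun i => (g i).symm) p)^[r] f x ∂(m : Measure UnitAddCircle)
      = 0 := by
    have := integral_markovOperator_iterate (fun i => (g i).symm) p r m.toFiniteMeasure f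
    rw [Function.iterate_fixed hm] at this
    refine this.symm.trans (integral_eq_zero_of_ae ?_)
    have hae : ∀ᵐ x ∂(m : Measure UnitAddCircle), x ∈ Uᶜ := by
      rw [ae_iff]
      simpa using hzero
    exact hae.mono fun x hx => hf0 hx
  have hpos' := (integral_pos_iff_support_of_nonneg (fun x => (hr x).le)
    (integrable_continuousMap _ (m : Measure UnitAddCircle))).2 (by
      rw [Function.support_eq_univ fun x => (hr x).ne']
      simp)
  exact hpos'.ne' hint

/-- An invariant measure of the inverse system has no atoms. -/
lemma measure_singleton_of_symm_invariant {α β : ℝ} (hαβ : Irrational (α - β))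
    (hα : ∃ i, g i = circleRotation α) (hβ : ∃ j, g j = circleRotation β)
    (hpos : ∀ i, 0 < p i) (hp : ∑ i, p i = 1) {m : ProbabilityMeasure UnitAddCircle}
    (hm : markovOperator (fun i => (g i).symm) p m.toFiniteMeasure = m.toFiniteMeasure)
    (x : UnitAddCircle) : (m : Measure UnitAddCircle) {x} = 0 := by
  by_contra hx
  let w (y : UnitAddCircle) : ℝ := (m : Measure UnitAddCircle).real {y}
  have hxpos : 0 < w x := ENNReal.toReal_pos hx (by finiteness)
  have hfin : {y | w x ≤ w y}.Finite := by
    have := Measure.finite_const_le_meas_of_disjoint_iUnion (m : Measure UnitAddCircle)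
      (ε := (m : Measure UnitAddCircle) {x}) (pos_iff_ne_zero.2 hx)
      (As := fun y : UnitAddCircle => {y}) (fun y => measurableSet_singleton y)
      (fun y z hyz => by simpa using hyz) (by finiteness)
    refine this.subset fun y hy => ?_
    exact (ENNReal.toReal_le_toReal (by finiteness) (by finiteness)).1 hy
  obtain ⟨y, hy, hymax⟩ := Set.exists_max_image _ w hfin ⟨x, le_refl (w x)⟩
  have hymax' (z : UnitAddCircle) : w z ≤ w y := by
    by_cases hz : w x ≤ w z
    · exact hymax z hz
    · exact (not_le.1 hz).le.trans hy
  have hp' : ∑ i, (p i : ℝ) = 1 := by exact_mod_cast hp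
  have hinv (i : Fin k) (z : UnitAddCircle) (hz : w z = w y) : w (g i z) = w y := by
    have h1 : ∑ j, (p j : ℝ) * w (g j z) = ∑ j, (p j : ℝ) * w y := by
      rw [← Finset.sum_mul, hp', one_mul, ← hz]
      have := measure_eq_sum_of_symm_invariant hm {z}
      simp only [Set.image_singleton] at this
      exact this.symm
    have h2 := (Finset.sum_eq_sum_iff_of_le fun j _ =>
      mul_le_mul_of_nonneg_left (hymax' _) (NNReal.coe_nonneg (p j))).1 h1 i (Finset.mem_univ i)
    exact mul_left_cancel₀ (NNReal.coe_pos.2 (hpos i)).ne' h2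
  have hsub : {z | w z = w y} ⊆ {z | w x ≤ w z} := fun z hz => le_of_le_of_eq hy hz.symm
  have hfin' := hfin.subset hsub
  obtain ⟨i, hi⟩ := hα
  obtain ⟨j, hj⟩ := hβ
  have hrotα (z : UnitAddCircle) (hz : w z = w y) : w (z + (α : UnitAddCircle)) = w y := by
    simpa [hi, circleRotation] using hinv i z hz
  have hrotβ : Set.SurjOn (fun z => z + (β : UnitAddCircle)) {z | w z = w y} {z | w z = w y} :=
    (hfin'.surjOn_iff_bijOn_of_mapsTo fun z hz => by
      simpa [hj, circleRotation] using hinv j z hz).2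
      (hfin'.injOn_iff_bijOn_of_mapsTo (fun z hz => by
      simpa [hj, circleRotation] using hinv j z hz) |>.1 (add_left_injective _).injOn)
  have hdiff (n : ℕ) : w (y + n • ((α - β : ℝ) : UnitAddCircle)) = w y := by
    induction n with
    | zero => simp
    | succ n ih =>
      obtain ⟨z, hz, hzeq⟩ := hrotβ ih
      have := hrotα z hz
      convert this using 2
      rw [succ_nsmul, ← add_assoc, ← hzeq, AddCircle.coe_sub]
      change z + (β : UnitAddCircle) + (α - β) = z + (α : UnitAddCircle)
      abel
  have hclosed : closure (Set.range fun n : ℕ => n • ((α - β : ℝ) : UnitAddCircle)) ⊆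
      (fun z => y + z) ⁻¹' {z | w z = w y} :=
    closure_minimal (Set.range_subset_iff.2 hdiff)
      (hfin'.isClosed.preimage (continuous_const_add y))
  rw [(denseRange_nsmul_coe_of_irrational hαβ).closure_range] at hclosed
  have huniv : (Set.univ : Set UnitAddCircle) ⊆ {z | w z = w y} := fun z _ => by
    simpa using hclosed (Set.mem_univ (-y + z))
  have : Infinite UnitAddCircle :=
    (AddCircle.equivIco 1 0).infinite_iff.2 (Set.Ico_infinite (by norm_num)).to_subtype
  exact (Set.infinite_univ (α := UnitAddCircle)) (hfin'.subset huniv)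

end BackwardInvariantMeasure

section Equicontinuity

variable {k : ℕ} {g : Fin k → (UnitAddCircle ≃ₜ UnitAddCircle)} {p : Fin k → ℝ≥0}

/-- The arc of the circle which is the projection of the interval `[a, b]`. -/
def circleArc (a b : ℝ) : Set UnitAddCircle := (fun t : ℝ => (t : UnitAddCircle)) '' Set.Icc a b

lemma circleArc_subset {a b a' b' : ℝ} (ha : a ≤ a') (hb : b' ≤ b) :
    circleArc a' b' ⊆ circleArc a b :=
  Set.image_mono (Set.Icc_subset_Icc ha hb)

lemma circleArc_fract (a δ : ℝ) :
    circleArc (Int.fract a) (Int.fract a + δ) = circleArc a (a + δ) := by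
  have hcoe (t : ℝ) : ((t + ⌊a⌋ : ℝ) : UnitAddCircle) = t := by
    simp
  have : (fun t : ℝ => t + ⌊a⌋) '' Set.Icc (Int.fract a) (Int.fract a + δ) =
      Set.Icc a (a + δ) := by
    rw [Set.image_add_const_Icc, Int.fract_add_floor, add_right_comm, Int.fract_add_floor]
  rw [circleArc, circleArc, ← this, Set.image_image]
  simp only [hcoe]

/-- Arcs of a given length have measure bounded below when the measure has full support. -/
lemma exists_pos_le_measureReal_circleArc (m : Measure UnitAddCircle) [IsFiniteMeasure m]
    [m.IsOpenPosMeasure] {δ : ℝ} (hδ : 0 < δ) :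
    ∃ c : ℝ, 0 < c ∧ ∀ a, c ≤ m.real (circleArc a (a + δ)) := by
  have key : ∃ c : ℝ, 0 < c ∧ ∀ a ∈ Set.Icc (0 : ℝ) 1, c ≤ m.real (circleArc a (a + δ)) := by
    refine isCompact_Icc.induction_on ⟨1, one_pos, by simp⟩ ?_ ?_ ?_
    · rintro s t hst ⟨c, hc, h⟩
      exact ⟨c, hc, fun a ha => h a (hst ha)⟩
    · rintro s t ⟨c, hc, h⟩ ⟨c', hc', h'⟩
      exact ⟨min c c', lt_min hc hc', fun a ha => ha.elim
        (fun ha => (min_le_left _ _).trans (h a ha)) fun ha => (min_le_right _ _).trans (h' a ha)⟩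
    · intro a _
      have hne : m ((fun t : ℝ => (t : UnitAddCircle)) '' Set.Ioo (a + δ / 3) (a + 2 * δ / 3)) ≠ 0 :=
        (QuotientAddGroup.isOpenMap_coe _ isOpen_Ioo).measure_ne_zero m
          ((Set.nonempty_Ioo.2 (by linarith)).image _)
      refine ⟨Set.Ioo (a - δ / 3) (a + δ / 3), mem_nhdsWithin_of_mem_nhds
        (Ioo_mem_nhds (by linarith) (by linarith)), _, ENNReal.toReal_pos hne (by finiteness), ?_⟩
      intro b hb
      refine measureReal_mono (Set.image_mono fun t ht => ?_)
      constructor <;> linarith [ht.1, ht.2, hb.1, hb.2]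
  obtain ⟨c, hc, h⟩ := key
  refine ⟨c, hc, fun a => ?_⟩
  rw [← circleArc_fract]
  exact h _ ⟨Int.fract_nonneg a, (Int.fract_lt_one a).le⟩

/-- A continuous function varies along an arc by at most `ε` plus a multiple of the measure of the
arc. -/
lemma exists_abs_sub_le_add_mul_measureReal_circleArc (m : Measure UnitAddCircle)
    [IsFiniteMeasure m] [m.IsOpenPosMeasure] (f : C(UnitAddCircle, ℝ)) {ε : ℝ} (hε : 0 < ε) :
    ∃ C : ℝ, 0 ≤ C ∧ ∀ a b : ℝ, a ≤ b → |f a - f b| ≤ ε + C * m.real (circleArc a b) := by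
  obtain ⟨δ, hδ, hunif⟩ := Metric.uniformContinuous_iff.1
    (CompactSpace.uniformContinuous_of_continuous f.continuous) ε hε
  obtain ⟨c, hc, hle⟩ := exists_pos_le_measureReal_circleArc m hδ
  refine ⟨(‖f‖ + ‖f‖) / c, by positivity, fun a b hab => ?_⟩
  rcases lt_or_ge (b - a) δ with h | h
  · have hdist : dist (a : UnitAddCircle) b < δ := by
      rw [dist_eq_norm, ← AddCircle.coe_sub]
      refine (QuotientAddGroup.norm_mk_le_norm).trans_lt ?_
      rwa [Real.norm_eq_abs, abs_sub_comm, abs_of_nonneg (sub_nonneg.2 hab)]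
    have h1 := (hunif hdist).le
    rw [Real.dist_eq] at h1
    exact h1.trans (le_add_of_nonneg_right (by positivity))
  · have h1 : c ≤ m.real (circleArc a b) :=
      (hle a).trans (measureReal_mono (circleArc_subset le_rfl (by linarith)))
    calc |f a - f b| ≤ ‖f‖ + ‖f‖ := (norm_sub_le _ _).trans
          (add_le_add (f.norm_coe_le_norm _) (f.norm_coe_le_norm _))
      _ = (‖f‖ + ‖f‖) / c * c := by field_simp
      _ ≤ (‖f‖ + ‖f‖) / c * m.real (circleArc a b) := by gcongr
      _ ≤ _ := le_add_of_nonneg_left hε.le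

/-- An estimate of the variation along arcs by an invariant measure of the inverse system is
preserved by the dual operator. -/
lemma abs_dualOperator_sub_le_of_symm_invariant (hg : ∀ i, IsOrientationPreserving (g i))
    (hp : ∑ i, p i = 1) {m : ProbabilityMeasure UnitAddCircle}
    (hm : markovOperator (fun i => (g i).symm) p m.toFiniteMeasure = m.toFiniteMeasure)
    {f : C(UnitAddCircle, ℝ)} {ε C : ℝ} (h : ∀ a b : ℝ, a ≤ b →
      |f a - f b| ≤ ε + C * (m : Measure UnitAddCircle).real (circleArc a b))
    {a b : ℝ} (hab : a ≤ b) : |dualOperator g p f a - dualOperator g p f b| ≤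
      ε + C * (m : Measure UnitAddCircle).real (circleArc a b) := by
  have hp' : ∑ i, (p i : ℝ) = 1 := by exact_mod_cast hp
  have hterm (i : Fin k) : |f (g i a) - f (g i b)| ≤
      ε + C * (m : Measure UnitAddCircle).real (g i '' circleArc a b) := by
    obtain ⟨F, hFc, hFm, -, hF⟩ := hg i
    have himage : circleArc (F a) (F b) ⊆ g i '' circleArc a b := by
      rintro _ ⟨t, ht, rfl⟩
      obtain ⟨s, hs, rfl⟩ := intermediate_value_Icc hab hFc.continuousOn ht
      exact ⟨s, ⟨s, hs, rfl⟩, hF s⟩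
    have himage' : g i '' circleArc a b ⊆ circleArc (F a) (F b) := by
      rintro _ ⟨_, ⟨s, hs, rfl⟩, rfl⟩
      exact ⟨F s, ⟨hFm.monotone hs.1, hFm.monotone hs.2⟩, (hF s).symm⟩
    rw [hF, hF, himage'.antisymm himage]
    exact h _ _ (hFm.monotone hab)
  rw [dualOperator_apply, dualOperator_apply, ← Finset.sum_sub_distrib]
  calc |∑ i, ((p i : ℝ) * f (g i a) - (p i : ℝ) * f (g i b))|
      ≤ ∑ i, |(p i : ℝ) * f (g i a) - (p i : ℝ) * f (g i b)| := Finset.abs_sum_le_sum_abs _ _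
    _ ≤ ∑ i, (p i : ℝ) * (ε + C * (m : Measure UnitAddCircle).real (g i '' circleArc a b)) :=
        Finset.sum_le_sum fun i _ => by
          rw [← mul_sub, abs_mul, abs_of_nonneg (NNReal.coe_nonneg (p i))]
          exact mul_le_mul_of_nonneg_left (hterm i) (NNReal.coe_nonneg (p i))
    _ = ε + C * (m : Measure UnitAddCircle).real (circleArc a b) := by
        rw [measure_eq_sum_of_symm_invariant hm, Finset.mul_sum]
        simp only [mul_add, Finset.sum_add_distrib, ← Finset.sum_mul, hp', one_mul,
          mul_left_comm C]

/-- The iterates of the dual operator on a continuous function are equicontinuous. -/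
theorem equicontinuous_dualOperator_iterate (hg : ∀ i, IsOrientationPreserving (g i))
    {α β : ℝ} (hαβ : Irrational (α - β))
    (hα : ∃ i, g i = circleRotation α) (hβ : ∃ j, g j = circleRotation β)
    (hpos : ∀ i, 0 < p i) (hp : ∑ i, p i = 1) (f : C(UnitAddCircle, ℝ)) :
    Equicontinuous fun (n : ℕ) x => (dualOperator g p)^[n] f x := by
  obtain ⟨m, hm⟩ := exists_markovOperator_invariant (fun i => (g i).symm) hp
  have := isOpenPosMeasure_of_symm_invariant hαβ hα hβ hpos hm
  intro x
  rw [Metric.equicontinuousAt_iff_right]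
  intro ε hε
  obtain ⟨C, hC, hfC⟩ := exists_abs_sub_le_add_mul_measureReal_circleArc
    (m : Measure UnitAddCircle) f (half_pos hε)
  have hiter (n : ℕ) (a b : ℝ) (hab : a ≤ b) :
      |(dualOperator g p)^[n] f a - (dualOperator g p)^[n] f b| ≤
        ε / 2 + C * (m : Measure UnitAddCircle).real (circleArc a b) := by
    induction n generalizing a b with
    | zero => exact hfC a b hab
    | succ n ih =>
      rw [Function.iterate_succ_apply']
      exact abs_dualOperator_sub_le_of_symm_invariant hg hp hm ih hab
  have hη : 0 < ε / (2 * (C + 1)) := by positivity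
  obtain ⟨U, hxU, hU, hUm⟩ := Set.exists_isOpen_lt_of_lt {x} (ENNReal.ofReal (ε / (2 * (C + 1))))
    ((measure_singleton_of_symm_invariant hαβ hα hβ hpos hp hm x).trans_lt
      (ENNReal.ofReal_pos.2 hη))
  have hUr : (m : Measure UnitAddCircle).real U < ε / (2 * (C + 1)) :=
    (ENNReal.lt_ofReal_iff_toReal_lt (by finiteness)).1 hUm
  have hbound : C * (m : Measure UnitAddCircle).real U < ε / 2 := by
    calc C * (m : Measure UnitAddCircle).real U ≤ C * (ε / (2 * (C + 1))) := by gcongr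
      _ < (C + 1) * (ε / (2 * (C + 1))) := by gcongr; linarith
      _ = ε / 2 := by field_simp
  obtain ⟨t, rfl⟩ := QuotientAddGroup.mk_surjective x
  obtain ⟨ρ, hρ, hball⟩ := Metric.isOpen_iff.1
    (hU.preimage (AddCircle.continuous_mk' (1 : ℝ))) t (hxU rfl)
  have hsmall (n : ℕ) (a b : ℝ) (ha : a ∈ Metric.ball t ρ) (hb : b ∈ Metric.ball t ρ)
      (hab : a ≤ b) : |(dualOperator g p)^[n] f a - (dualOperator g p)^[n] f b| < ε := by
    have hsub : circleArc a b ⊆ U := by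
      rintro _ ⟨s, hs, rfl⟩
      exact hball ((convex_ball t ρ).ordConnected.out ha hb hs)
    have := mul_le_mul_of_nonneg_left
      (measureReal_mono (μ := (m : Measure UnitAddCircle)) hsub) hC
    linarith [hiter n a b hab]
  filter_upwards [(QuotientAddGroup.isOpenMap_coe _ Metric.isOpen_ball).mem_nhds
    ⟨t, Metric.mem_ball_self hρ, rfl⟩]
  rintro _ ⟨s, hs, rfl⟩ n
  rw [Real.dist_eq]
  rcases le_total t s with h | h
  · exact hsmall n t s (Metric.mem_ball_self hρ) hs h
  · rw [abs_sub_comm]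
    exact hsmall n s t hs (Metric.mem_ball_self hρ) h

end Equicontinuity

section Stability

variable {k : ℕ} {g : Fin k → (UnitAddCircle ≃ₜ UnitAddCircle)} {p : Fin k → ℝ≥0}

lemma exists_tendsto_subseq_of_equicontinuous {X : Type*} [TopologicalSpace X] [CompactSpace X]
    (u : ℕ → C(X, ℝ)) {R : ℝ} (hR : ∀ n, ‖u n‖ ≤ R)
    (hu : Equicontinuous fun (n : ℕ) x => u n x) :
    ∃ (h : C(X, ℝ)) (φ : ℕ → ℕ), StrictMono φ ∧ Tendsto (fun n => u (φ n)) atTop (𝓝 h) := by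
  let v (n : ℕ) := BoundedContinuousFunction.mkOfCompact (u n)
  have hcomp : IsCompact (closure (Set.range v)) := by
    refine BoundedContinuousFunction.arzela_ascoli (Metric.closedBall (0 : ℝ) R)
      (isCompact_closedBall _ _) _ ?_ ?_
    · rintro _ x ⟨n, rfl⟩
      rw [mem_closedBall_zero_iff]
      exact ((u n).norm_coe_le_norm x).trans (hR n)
    · intro x W hW
      filter_upwards [hu x W hW] with y hy
      rintro ⟨_, n, rfl⟩
      exact hy n
  obtain ⟨h, -, φ, hφ, hlim⟩ := hcomp.tendsto_subseq fun n => subset_closure (Set.mem_range_self n)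
  refine ⟨h.toContinuousMap, φ, hφ, ?_⟩
  exact ((ContinuousMap.isometryEquivBoundedOfCompact X ℝ).symm.continuous.tendsto h).comp hlim

lemma continuous_iSup_continuousMap {X : Type*} [TopologicalSpace X] [CompactSpace X] [Nonempty X] :
    Continuous fun f : C(X, ℝ) => ⨆ x, f x := by
  have hbdd (f : C(X, ℝ)) : BddAbove (Set.range f) := (isCompact_range f.continuous).bddAbove
  refine LipschitzWith.continuous (K := 1) (LipschitzWith.of_le_add_mul 1 fun f h => ?_)
  refine ciSup_le fun x => ?_
  have h1 : f x - h x ≤ dist f h := (le_abs_self _).trans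
    ((Real.dist_eq _ _).symm.trans_le (ContinuousMap.dist_apply_le_dist x))
  have h2 := le_ciSup (hbdd h) x
  rw [NNReal.coe_one, one_mul]
  linarith

/-- The iterates of the dual operator on a continuous function converge uniformly to a constant. -/
theorem exists_tendsto_dualOperator_iterate (hg : ∀ i, IsOrientationPreserving (g i))
    {α β : ℝ} (hαβ : Irrational (α - β))
    (hα : ∃ i, g i = circleRotation α) (hβ : ∃ j, g j = circleRotation β)
    (hpos : ∀ i, 0 < p i) (hp : ∑ i, p i = 1) (f : C(UnitAddCircle, ℝ)) :
    ∃ c : ℝ, Tendsto (fun n => (dualOperator g p)^[n] f) atTop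
      (𝓝 (ContinuousMap.const _ c)) := by
  let S (f : C(UnitAddCircle, ℝ)) : ℝ := ⨆ x, f x
  have hS : Continuous S := continuous_iSup_continuousMap
  have hle (f : C(UnitAddCircle, ℝ)) (x : UnitAddCircle) : f x ≤ S f :=
    le_ciSup (isCompact_range f.continuous).bddAbove x
  obtain ⟨h, φ, hφ, hlim⟩ := exists_tendsto_subseq_of_equicontinuous
    (fun n => (dualOperator g p)^[n] f) (norm_dualOperator_iterate_le g hp f)
    (equicontinuous_dualOperator_iterate hg hαβ hα hβ hpos hp f)
  have hanti : Antitone fun n => S ((dualOperator g p)^[n] f) :=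
    antitone_nat_of_succ_le fun n => ciSup_le fun x => by
      rw [Function.iterate_succ_apply']
      exact dualOperator_le_of_forall_le g hp (hle _) x
  have hbelow : BddBelow (Set.range fun n => S ((dualOperator g p)^[n] f)) := by
    refine ⟨-‖f‖, ?_⟩
    rintro _ ⟨n, rfl⟩
    have h1 := ((dualOperator g p)^[n] f).norm_coe_le_norm 0
    have h2 := norm_dualOperator_iterate_le g hp f n
    have h3 := neg_abs_le ((dualOperator g p)^[n] f 0)
    rw [Real.norm_eq_abs] at h1
    exact le_trans (by linarith) (hle _ 0)
  have hM := tendsto_atTop_ciInf hanti hbelow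
  set M := ⨅ n, S ((dualOperator g p)^[n] f)
  have hSr (r : ℕ) : S ((dualOperator g p)^[r] h) = M := by
    have h1 := (hS.comp ((continuous_dualOperator g hp).iterate r)).tendsto h |>.comp hlim
    refine tendsto_nhds_unique h1 ?_
    refine (hM.comp (tendsto_atTop_mono (fun n => Nat.le_add_left (φ n) r)
      hφ.tendsto_atTop)).congr fun n => ?_
    simp only [Function.comp_apply, Function.iterate_add_apply]
  have hconst : h = ContinuousMap.const _ M := by
    by_contra hne
    obtain ⟨r, -, hr⟩ := exists_dualOperator_iterate_pos g hαβ hα hβ hpos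
      (f := ContinuousMap.const _ M - h)
      (fun x => sub_nonneg.2 ((hle h x).trans_eq (hSr 0))) (by
        by_contra! hall
        exact hne (sub_eq_zero.1 (ContinuousMap.ext hall)).symm)
    rw [dualOperator_iterate_sub, dualOperator_iterate_const g hp] at hr
    obtain ⟨x, -, hx⟩ := isCompact_univ.exists_isMaxOn Set.univ_nonempty
      ((dualOperator g p)^[r] h).continuous.continuousOn
    have h1 : S ((dualOperator g p)^[r] h) ≤ (dualOperator g p)^[r] h x :=
      ciSup_le fun y => hx (Set.mem_univ y)
    rw [hSr] at h1
    exact absurd (hr x) (not_lt.2 (sub_nonpos.2 h1))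
  refine ⟨M, ?_⟩
  rw [hconst, tendsto_iff_norm_sub_tendsto_zero] at hlim
  rw [tendsto_iff_norm_sub_tendsto_zero]
  have hanti' : Antitone fun n => ‖(dualOperator g p)^[n] f - ContinuousMap.const _ M‖ :=
    antitone_nat_of_succ_le fun n => by
      have := norm_dualOperator_le g hp ((dualOperator g p)^[n] f - ContinuousMap.const _ M)
      rwa [dualOperator_sub, dualOperator_const g hp, ← Function.iterate_succ_apply' (dualOperator g p)] at this
  have hconv := tendsto_atTop_ciInf hanti'
    ⟨0, by rintro _ ⟨n, rfl⟩; exact norm_nonneg _⟩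
  rwa [tendsto_nhds_unique (hconv.comp hφ.tendsto_atTop) hlim] at hconv

lemma tendsto_integral_of_tendsto_const {u : ℕ → C(UnitAddCircle, ℝ)} {c : ℝ}
    (h : Tendsto u atTop (𝓝 (ContinuousMap.const _ c))) (μ : ProbabilityMeasure UnitAddCircle) :
    Tendsto (fun n => ∫ x, u n x ∂(μ : Measure UnitAddCircle)) atTop (𝓝 c) := by
  rw [tendsto_iff_norm_sub_tendsto_zero] at h ⊢
  refine squeeze_zero (fun n => norm_nonneg _) (fun n => ?_) h
  have h1 : ∫ x, u n x ∂(μ : Measure UnitAddCircle) - c =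
      ∫ x, (u n - ContinuousMap.const UnitAddCircle c : C(UnitAddCircle, ℝ)) x ∂(μ : Measure UnitAddCircle) := by
    simp [integral_sub (integrable_continuousMap (u n) _) (integrable_const c)]
  rw [h1]
  simpa using norm_integral_le_of_norm_le_const (μ := (μ : Measure UnitAddCircle))
    (Eventually.of_forall (u n - ContinuousMap.const UnitAddCircle c : C(UnitAddCircle, ℝ)).norm_coe_le_norm)

end Stability

theorem mainTheorem8 {k : ℕ} (g : Fin k → (UnitAddCircle ≃ₜ UnitAddCircle))
    (hg : ∀ i, IsOrientationPreserving (g i))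
    (α β : ℝ) (hαβ : Irrational (α - β))
    (hα : ∃ i, g i = circleRotation α) (hβ : ∃ j, g j = circleRotation β)
    (p : Fin k → ℝ≥0) (hp_pos : ∀ i, 0 < p i) (hp_sum : ∑ i, p i = 1) :
    (∀ f : C(UnitAddCircle, ℝ), (∀ x, 0 ≤ f x) → (∃ x, f x ≠ 0) →
      ∃ r : ℕ, 1 ≤ r ∧ ∀ x, 0 < ((dualOperator g p)^[r] f) x) ∧
    IsAsymptoticallyStable (markovOperator g p) := by

  refine ⟨fun f hf hne => exists_dualOperator_iterate_pos g hαβ hα hβ hp_pos hf hne, ?_⟩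
  obtain ⟨μs, hμs⟩ := exists_markovOperator_invariant g hp_sum
  have hlim (f : C(UnitAddCircle, ℝ)) (ν : ProbabilityMeasure UnitAddCircle) :
      Tendsto (fun n : ℕ => ∫ x, f x
        ∂((markovOperator g p)^[n] ν.toFiniteMeasure : Measure UnitAddCircle)) atTop
        (𝓝 (∫ x, f x ∂(μs : Measure UnitAddCircle))) := by
    obtain ⟨c, hc⟩ := exists_tendsto_dualOperator_iterate hg hαβ hα hβ hp_pos hp_sum f
    have hν (ν : ProbabilityMeasure UnitAddCircle) : Tendsto (fun n : ℕ => ∫ x, f x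
        ∂((markovOperator g p)^[n] ν.toFiniteMeasure : Measure UnitAddCircle)) atTop (𝓝 c) := by
      simp only [integral_markovOperator_iterate]
      exact tendsto_integral_of_tendsto_const hc ν
    have hs := hν μs
    simp only [Function.iterate_fixed hμs] at hs
    rw [show ∫ x, f x ∂(μs : Measure UnitAddCircle) = c from
      tendsto_nhds_unique tendsto_const_nhds hs]
    exact hν ν
  refine ⟨μs, hμs, fun ν hν => ?_, hlim⟩
  refine Subtype.ext (congrArg FiniteMeasure.toMeasure (?_ : ν.toFiniteMeasure = μs.toFiniteMeasure))
  refine finiteMeasure_ext_of_integral_continuousMap fun f => ?_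
  have := hlim f ν
  simp only [Function.iterate_fixed hν] at this
  exact tendsto_nhds_unique tendsto_const_nhds this
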